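/- Let $n\ge 1$, let $\mathbb T$ be the unit circle in $\mathbb C$, and let $p\in\{0,1,2,\dots\}\cup\{\infty\}$. Let $C^p(\mathbb T^n)$ be the space of functions $f:\mathbb T^n\to\mathbb C$ whose derivatives $$\frac{\partial^{\alpha}f}{\partial\theta^{\alpha}}(e^{i\theta_1},\dots,e^{i\theta_n})=\frac{\partial^{|\alpha|}}{\partial\theta_1^{a_1}\cdots\partial\theta_n^{a_n}}\,f(e^{i\theta_1},\dots,e^{i\theta_n})$$ exist and are continuous for all multi-indices $\alpha=(a_1,\dots,a_n)\in\mathbb N^n$ with $|\alpha|=a_1+\cdots+a_n\le p$, with the topology generated by the seminorms $|f|_\alpha=\sup_{\theta\in\mathbb R^n}\left|\frac{\partial^{\alpha}f}{\partial\theta^{\alpha}}(e^{i\theta_1},\dots,e^{i\theta_n})\right|$, $|\alpha|\le p$. A function $f:\mathbb T^n\to\mathbb C$ is called real analytic at the point $(e^{i\theta_1},\dots,e^{i\theta_n})$ if the function $(t_1,\dots,t_n)\mapsto f(e^{it_1},\dots,e^{it_n})$ is, in a neighbourhood of $(\theta_1,\dots,\theta_n)$ in $\mathbb R^n$, the sum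 of a convergent power series in $t_1-\theta_1,\dots,t_n-\theta_n$. Then: 1. for every $\zeta\in\mathbb T^n$, the set of all $f\in C^p(\mathbb T^n)$ that are not real analytic at $\zeta$ is a dense $G_\delta$ subset of $C^p(\mathbb T^n)$; 2. the set of all $f\in C^p(\mathbb T^n)$ that are not real analytic at any point of $\mathbb T^n$ is a dense $G_\delta$ subset of $C^p(\mathbb T^n)$. -/

import Mathlib

open scoped ContDiff

noncomputable section

namespace TorusCp

/-- The function `(θ₁, …, θₙ) ↦ f (e^{iθ₁}, …, e^{iθₙ})` on `ℝⁿ` attached to a function `f` on the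
torus `𝕋ⁿ`, where `𝕋` is the unit circle in `ℂ`. -/
def lift {n : ℕ} (f : (Fin n → Circle) → ℂ) : (Fin n → ℝ) → ℂ :=
  fun θ => f (fun i => Circle.exp (θ i))

/-- The partial derivative `∂g/∂θᵢ`. -/
def partialDeriv {n : ℕ} (i : Fin n) (g : (Fin n → ℝ) → ℂ) : (Fin n → ℝ) → ℂ :=
  fun θ => lineDeriv ℝ g θ (Pi.single i 1)

/-- Iterated partial derivatives `∂ᵢ₁^{α i₁} (∂ᵢ₂^{α i₂} (⋯ g))` along a list `i₁, i₂, …`. -/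
def partialsAlong {n : ℕ} (α : Fin n → ℕ) (l : List (Fin n)) (g : (Fin n → ℝ) → ℂ) :
    (Fin n → ℝ) → ℂ :=
  l.foldr (fun i h => (partialDeriv i)^[α i] h) g

/-- The derivative `∂^{|α|} g / ∂θ₁^{α₁} ⋯ ∂θₙ^{αₙ}`. -/
def multiDeriv {n : ℕ} (α : Fin n → ℕ) (g : (Fin n → ℝ) → ℂ) : (Fin n → ℝ) → ℂ :=
  partialsAlong α (List.finRange n) g

/-- The linear space of functions `f : 𝕋ⁿ → ℂ` that are `p` times continuously differentiable in
the angular variables `θ₁, …, θₙ`. -/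
def cpSubmodule (n : ℕ) (p : ℕ∞) : Submodule ℂ ((Fin n → Circle) → ℂ) where
  carrier := {f | ContDiff ℝ (p : ℕ∞ω) (lift f)}
  add_mem' {f g} hf hg := by
    have hf' : ContDiff ℝ (p : ℕ∞ω) (lift f) := hf
    have hg' : ContDiff ℝ (p : ℕ∞ω) (lift g) := hg
    exact hf'.add hg'
  zero_mem' := (contDiff_const : ContDiff ℝ (p : ℕ∞ω) fun _ : Fin n → ℝ => (0 : ℂ))
  smul_mem' c f hf := by
    have hf' : ContDiff ℝ (p : ℕ∞ω) (lift f) := hf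
    exact hf'.const_smul c

/-- The space `C^p(𝕋ⁿ)`, `p ∈ {0, 1, …} ∪ {∞}`. It is a type of its own, so that it does not inherit
the topology of pointwise convergence. -/
def CpTorus (n : ℕ) (p : ℕ∞) : Type := cpSubmodule n p

instance (n : ℕ) (p : ℕ∞) : AddCommGroup (CpTorus n p) :=
  inferInstanceAs (AddCommGroup (cpSubmodule n p))

instance (n : ℕ) (p : ℕ∞) : Module ℂ (CpTorus n p) :=
  inferInstanceAs (Module ℂ (cpSubmodule n p))

instance (n : ℕ) (p : ℕ∞) : FunLike (CpTorus n p) (Fin n → Circle) ℂ where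
  coe f := f.1
  coe_injective := Subtype.val_injective

/-! ### The derivatives are linear in `f` and bounded -/

theorem contDiff_partialDeriv {n m : ℕ} (i : Fin n) {g : (Fin n → ℝ) → ℂ}
    (hg : ContDiff ℝ (m + 1 : ℕ) g) : ContDiff ℝ m (partialDeriv i g) := by
  have h : partialDeriv i g = fun θ => fderiv ℝ g θ (Pi.single i 1) := by
    funext θ
    exact (hg.differentiable (by simp) θ).lineDeriv_eq_fderiv
  rw [h]
  exact (hg.fderiv_right (m := m) (by simp)).clm_apply contDiff_const

theorem partialDeriv_add {n m : ℕ} (i : Fin n) {g h : (Fin n → ℝ) → ℂ}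
    (hg : ContDiff ℝ (m + 1 : ℕ) g) (hh : ContDiff ℝ (m + 1 : ℕ) h) :
    partialDeriv i (g + h) = partialDeriv i g + partialDeriv i h := by
  funext θ
  have h1 := (hg.differentiable (by simp) θ)
  have h2 := (hh.differentiable (by simp) θ)
  simp only [partialDeriv, Pi.add_apply]
  rw [(h1.add h2).lineDeriv_eq_fderiv, h1.lineDeriv_eq_fderiv, h2.lineDeriv_eq_fderiv,
    fderiv_add h1 h2]
  rfl

theorem partialDeriv_smul {n m : ℕ} (i : Fin n) (c : ℂ) {g : (Fin n → ℝ) → ℂ}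
    (hg : ContDiff ℝ (m + 1 : ℕ) g) :
    partialDeriv i (c • g) = c • partialDeriv i g := by
  funext θ
  have h1 := (hg.differentiable (by simp) θ)
  simp only [partialDeriv, Pi.smul_apply]
  rw [(h1.const_smul c).lineDeriv_eq_fderiv, h1.lineDeriv_eq_fderiv, fderiv_const_smul h1 c]
  rfl

theorem iterate_spec {n : ℕ} (i : Fin n) (k m : ℕ) (g h : (Fin n → ℝ) → ℂ) (c : ℂ)
    (hg : ContDiff ℝ (m + k : ℕ) g) (hh : ContDiff ℝ (m + k : ℕ) h) :
    ContDiff ℝ m ((partialDeriv i)^[k] g) ∧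
    (partialDeriv i)^[k] (g + h) = (partialDeriv i)^[k] g + (partialDeriv i)^[k] h ∧
    (partialDeriv i)^[k] (c • g) = c • (partialDeriv i)^[k] g := by
  induction k generalizing g h with
  | zero => exact ⟨hg, rfl, rfl⟩
  | succ k ih =>
    have hg' : ContDiff ℝ ((m + k) + 1 : ℕ) g := hg
    have hh' : ContDiff ℝ ((m + k) + 1 : ℕ) h := hh
    simp only [Function.iterate_succ, Function.comp]
    rw [partialDeriv_add i hg' hh', partialDeriv_smul i c hg']
    exact ih _ _ (contDiff_partialDeriv i hg') (contDiff_partialDeriv i hh')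

theorem partialsAlong_spec {n : ℕ} (α : Fin n → ℕ) (l : List (Fin n)) (m : ℕ)
    (g h : (Fin n → ℝ) → ℂ) (c : ℂ)
    (hg : ContDiff ℝ (m + (l.map α).sum : ℕ) g) (hh : ContDiff ℝ (m + (l.map α).sum : ℕ) h) :
    ContDiff ℝ m (partialsAlong α l g) ∧
    partialsAlong α l (g + h) = partialsAlong α l g + partialsAlong α l h ∧
    partialsAlong α l (c • g) = c • partialsAlong α l g := by
  induction l generalizing m g h with
  | nil => exact ⟨by simpa [partialsAlong] using hg, rfl, rfl⟩
  | cons i l ih =>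
    rw [List.map_cons, List.sum_cons, ← add_assoc] at hg hh
    obtain ⟨h1, h2, h3⟩ := ih (m + α i) g h hg hh
    obtain ⟨k1, -, -⟩ := ih (m + α i) h h hh hh
    obtain ⟨j1, j2, j3⟩ := iterate_spec i (α i) m _ _ c h1 k1
    refine ⟨j1, ?_, ?_⟩
    · exact (congrArg ((partialDeriv i)^[α i]) h2).trans j2
    · exact (congrArg ((partialDeriv i)^[α i]) h3).trans j3

theorem multiDeriv_spec {n : ℕ} {p : ℕ∞} {α : Fin n → ℕ} (hα : ((∑ i, α i : ℕ) : ℕ∞) ≤ p)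
    (f g : CpTorus n p) (c : ℂ) :
    Continuous (multiDeriv α (lift f)) ∧
    multiDeriv α (lift ⇑(f + g)) = multiDeriv α (lift f) + multiDeriv α (lift g) ∧
    multiDeriv α (lift ⇑(c • f)) = c • multiDeriv α (lift f) := by
  have key : ∀ f : CpTorus n p,
      ContDiff ℝ (0 + ((List.finRange n).map α).sum : ℕ) (lift f) := by
    intro f
    have h : ((List.finRange n).map α).sum = ∑ i, α i := by
      rw [← List.ofFn_eq_map, List.sum_ofFn]
    rw [h, zero_add]
    have hf : ContDiff ℝ (p : ℕ∞ω) (lift f) := f.2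
    exact hf.of_le (by exact_mod_cast hα)
  obtain ⟨h1, h2, h3⟩ := partialsAlong_spec α (List.finRange n) 0 _ _ c (key f) (key g)
  exact ⟨h1.continuous, h2, h3⟩

theorem partialsAlong_congr_exp {n : ℕ} (α : Fin n → ℕ) (l : List (Fin n))
    (f : (Fin n → Circle) → ℂ) (θ θ' : Fin n → ℝ)
    (h : ∀ i, Circle.exp (θ i) = Circle.exp (θ' i)) :
    partialsAlong α l (lift f) θ = partialsAlong α l (lift f) θ' := by
  have step : ∀ (i : Fin n) (g : (Fin n → ℝ) → ℂ),
      (∀ θ θ' : Fin n → ℝ, (∀ i, Circle.exp (θ i) = Circle.exp (θ' i)) → g θ = g θ') →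
      ∀ θ θ' : Fin n → ℝ, (∀ i, Circle.exp (θ i) = Circle.exp (θ' i)) →
        partialDeriv i g θ = partialDeriv i g θ' := by
    intro i g hg θ θ' h
    unfold partialDeriv lineDeriv
    congr 1
    funext t
    apply hg
    intro j
    simp only [Pi.add_apply, Circle.exp_add, h j]
  induction l generalizing θ θ' with
  | nil => exact congrArg f (funext h)
  | cons i l ih =>
    have aux : ∀ (k : ℕ) (θ θ' : Fin n → ℝ), (∀ i, Circle.exp (θ i) = Circle.exp (θ' i)) →
        (partialDeriv i)^[k] (partialsAlong α l (lift f)) θ =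
          (partialDeriv i)^[k] (partialsAlong α l (lift f)) θ' := by
      intro k
      induction k with
      | zero => exact fun θ θ' h => ih θ θ' h
      | succ k ihk =>
        rw [Function.iterate_succ_apply']
        exact step i _ ihk
    exact aux (α i) θ θ' h

theorem bddAbove_multiDeriv {n : ℕ} {p : ℕ∞} {α : Fin n → ℕ}
    (hα : ((∑ i, α i : ℕ) : ℕ∞) ≤ p) (f : CpTorus n p) :
    BddAbove (Set.range fun θ => ‖multiDeriv α (lift f) θ‖) := by
  have hc := (multiDeriv_spec hα f f 0).1.norm
  have hK : IsCompact (Set.univ.pi fun _ : Fin n => Set.Icc (-Real.pi) Real.pi) :=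
    isCompact_univ_pi fun _ => isCompact_Icc
  refine (hK.image hc).bddAbove.mono ?_
  rintro _ ⟨θ, rfl⟩
  refine ⟨fun i => Complex.arg (Circle.exp (θ i)), fun i _ => ?_, ?_⟩
  · exact Set.Ioc_subset_Icc_self (Complex.arg_mem_Ioc _)
  · exact congrArg norm (partialsAlong_congr_exp α _ f _ _ fun i => Circle.exp_arg _)

/-! ### The topology of `C^p(𝕋ⁿ)` and real analyticity -/

/-- The seminorm `|f|_α = sup_θ |∂^α f / ∂θ^α (e^{iθ₁}, …, e^{iθₙ})|`, for `|α| ≤ p`. -/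
def supSeminorm {n : ℕ} {p : ℕ∞} (α : Fin n → ℕ) (hα : ((∑ i, α i : ℕ) : ℕ∞) ≤ p) :
    Seminorm ℂ (CpTorus n p) :=
  Seminorm.of (fun f => ⨆ θ : Fin n → ℝ, ‖multiDeriv α (lift f) θ‖)
    (by
      intro f g
      refine ciSup_le fun θ => ?_
      rw [(multiDeriv_spec hα f g 0).2.1]
      exact (norm_add_le _ _).trans (add_le_add (le_ciSup (bddAbove_multiDeriv hα f) θ)
        (le_ciSup (bddAbove_multiDeriv hα g) θ)))
    (by
      intro c f
      rw [(multiDeriv_spec hα f f c).2.2, Real.mul_iSup_of_nonneg (norm_nonneg c)]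
      exact iSup_congr fun θ => norm_smul c _)

/-- The family of seminorms `|·|_α`, indexed by the multi-indices `α` with `|α| ≤ p`. -/
def seminormFamily (n : ℕ) (p : ℕ∞) :
    SeminormFamily ℂ (CpTorus n p) {α : Fin n → ℕ // ((∑ i, α i : ℕ) : ℕ∞) ≤ p} :=
  fun α => supSeminorm α.1 α.2

/-- `C^p(𝕋ⁿ)` carries the locally convex topology generated by the seminorms `|·|_α`,
`|α| ≤ p`. -/
instance (n : ℕ) (p : ℕ∞) : TopologicalSpace (CpTorus n p) :=
  (seminormFamily n p).moduleFilterBasis.topology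

/-- `f : 𝕋ⁿ → ℂ` is real analytic at `ζ = (e^{iθ₁}, …, e^{iθₙ})` if
`t ↦ f (e^{it₁}, …, e^{itₙ})` is the sum of a convergent power series in `t` near
`θ = (θ₁, …, θₙ)`. -/
def RealAnalyticAt {n : ℕ} (f : (Fin n → Circle) → ℂ) (ζ : Fin n → Circle) : Prop :=
  ∃ θ : Fin n → ℝ, (∀ i, Circle.exp (θ i) = ζ i) ∧ AnalyticAt ℝ (lift f) θ

end TorusCp

end

noncomputable section

namespace TorusCp

open Filter Topology

/-! ### A lacunary trigonometric series that is smooth and nowhere analytic -/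

/-! `G_δ`: a function is analytic at `θ` iff, for some `N`, near `θ` it is the sum of a power series
with m-th coefficient at most `(N+1)^(m+1)` in norm. For fixed `N` these coefficient sequences form
a compact space, so such functions form a closed set (`isClosed_boundedAnalyticSet`), and the
analytic ones a countable union of closed sets. Analyticity is an open condition on the point, so
for the second claim a countable dense set of points suffices. Density needs no Baire argument, only
one smooth nowhere analytic `h`, here a lacunary series in one variable. At a given point `f + ε h`
is analytic for at most one `ε`, so all but countably many `ε` are good, and `ε` can tend to 0
through good values. -/

/-- The general term `2^{-k²} e^{i 2^k x}` of a lacunary trigonometric series. -/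
def lacunaryTerm (k : ℕ) (x : ℝ) : ℂ :=
  ((2 : ℂ) ^ (k ^ 2))⁻¹ * Complex.exp ((2 ^ k * Complex.I) * x)

/-- The lacunary trigonometric series `∑ 2^{-k²} e^{i 2^k x}`. -/
def lacunary (x : ℝ) : ℂ := ∑' k, lacunaryTerm k x

theorem iteratedDeriv_const_mul_cexp_ofReal (m : ℕ) (a c : ℂ) :
    iteratedDeriv m (fun x : ℝ => a * Complex.exp (c * x)) =
      fun x : ℝ => a * c ^ m * Complex.exp (c * x) := by
  induction m with
  | zero => simp
  | succ m ih =>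
    rw [iteratedDeriv_succ, ih]
    funext x
    have h : HasDerivAt (fun x : ℝ => Complex.exp (c * x)) (Complex.exp (c * x) * (c * 1)) x :=
      ((Complex.ofRealCLM.hasDerivAt (x := x)).const_mul c).cexp
    rw [(h.const_mul (a * c ^ m)).deriv]
    ring

theorem analyticAt_lacunaryTerm (k : ℕ) (x : ℝ) : AnalyticAt ℝ (lacunaryTerm k) x := by
  have h : AnalyticAt ℝ (fun x : ℝ => (2 ^ k * Complex.I) * (x : ℂ)) x :=
    analyticAt_const.mul (Complex.ofRealCLM.analyticAt x)
  exact analyticAt_const.mul (AnalyticAt.comp (g := Complex.exp) analyticAt_cexp.restrictScalars h)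

theorem iteratedDeriv_lacunaryTerm (m k : ℕ) (x : ℝ) :
    iteratedDeriv m (lacunaryTerm k) x =
      ((2 : ℂ) ^ (k ^ 2))⁻¹ * (2 ^ k * Complex.I) ^ m *
        Complex.exp ((2 ^ k * Complex.I) * x) :=
  congrFun (iteratedDeriv_const_mul_cexp_ofReal m _ _) x

theorem norm_cexp_two_pow_mul_I (k : ℕ) (x : ℝ) :
    ‖Complex.exp ((2 ^ k * Complex.I) * x)‖ = 1 := by
  have : (2 ^ k * Complex.I) * (x : ℂ) = ((2 ^ k * x : ℝ) : ℂ) * Complex.I := by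
    push_cast; ring
  rw [this, Complex.norm_exp_ofReal_mul_I]

theorem norm_iteratedFDeriv_lacunaryTerm (m k : ℕ) (x : ℝ) :
    ‖iteratedFDeriv ℝ m (lacunaryTerm k) x‖ = ((2 : ℝ) ^ (k ^ 2))⁻¹ * (2 ^ k) ^ m := by
  rw [norm_iteratedFDeriv_eq_norm_iteratedDeriv, iteratedDeriv_lacunaryTerm]
  simp [norm_cexp_two_pow_mul_I]

theorem summable_lacunary_bound (m : ℕ) :
    Summable fun k : ℕ => ((2 : ℝ) ^ (k ^ 2))⁻¹ * (2 ^ k) ^ m := by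
  refine Summable.of_norm_bounded_eventually_nat
    (summable_geometric_of_lt_one (r := (1 / 2 : ℝ)) (by norm_num) (by norm_num)) ?_
  -- From here on `k * m + k ≤ k ^ 2`, so the term is at most `2^(-k)`.
  filter_upwards [eventually_ge_atTop (m + 1)] with k hk
  rw [Real.norm_of_nonneg (by positivity), one_div, inv_pow, inv_mul_le_iff₀ (by positivity),
    ← div_eq_mul_inv, le_div_iff₀ (by positivity), ← pow_mul, ← pow_add]
  exact pow_le_pow_right₀ (by norm_num) (by nlinarith)

theorem contDiff_lacunaryTerm (k : ℕ) : ContDiff ℝ ((⊤ : ℕ∞) : ℕ∞ω) (lacunaryTerm k) :=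
  contDiff_iff_contDiffAt.2 fun x => (analyticAt_lacunaryTerm k x).contDiffAt

theorem contDiff_lacunary : ContDiff ℝ ((⊤ : ℕ∞) : ℕ∞ω) lacunary :=
  contDiff_tsum (v := fun m k => ((2 : ℝ) ^ (k ^ 2))⁻¹ * (2 ^ k) ^ m) contDiff_lacunaryTerm
    (fun m _ => summable_lacunary_bound m)
    fun m k x _ => (norm_iteratedFDeriv_lacunaryTerm m k x).le

theorem summable_lacunaryTerm (x : ℝ) : Summable fun k => lacunaryTerm k x := by
  refine Summable.of_norm_bounded (summable_lacunary_bound 0) fun k => ?_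
  simp [lacunaryTerm, norm_cexp_two_pow_mul_I]

/-- At 0 every exponential equals 1, so all terms share the phase `I ^ m` and nothing cancels. -/
theorem iteratedDeriv_lacunary_zero (m : ℕ) :
    iteratedDeriv m lacunary 0 =
      Complex.I ^ m * ((∑' k : ℕ, ((2 : ℝ) ^ (k ^ 2))⁻¹ * (2 ^ k) ^ m : ℝ) : ℂ) := by
  have hle : ∀ (m k : ℕ) (x : ℝ), (m : ℕ∞) ≤ ⊤ → ‖iteratedFDeriv ℝ m (lacunaryTerm k) x‖ ≤
      ((2 : ℝ) ^ (k ^ 2))⁻¹ * (2 ^ k) ^ m :=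
    fun m k x _ => (norm_iteratedFDeriv_lacunaryTerm m k x).le
  have h := iteratedFDeriv_tsum_apply (v := fun m k => ((2 : ℝ) ^ (k ^ 2))⁻¹ * (2 ^ k) ^ m)
    contDiff_lacunaryTerm (fun m _ => summable_lacunary_bound m) hle (k := m) le_top (0 : ℝ)
  have hs : Summable fun k => iteratedFDeriv ℝ m (lacunaryTerm k) 0 :=
    Summable.of_norm_bounded (summable_lacunary_bound m) fun k => hle m k 0 le_top
  have h' : iteratedDeriv m lacunary 0 = ∑' k, iteratedDeriv m (lacunaryTerm k) 0 := by
    simp only [iteratedDeriv_eq_iteratedFDeriv]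
    rw [← ContinuousMultilinearMap.tsum_eval hs, ← h]
    rfl
  rw [h', Complex.ofReal_tsum, ← tsum_mul_left]
  refine tsum_congr fun k => ?_
  rw [iteratedDeriv_lacunaryTerm]
  push_cast
  simp only [mul_zero, Complex.exp_zero]
  ring

/-- The single term of index `k` suffices: at order `2 * k` its exponent is `2k² - k²`. -/
theorem two_pow_sq_le_norm_iteratedDeriv_lacunary (k : ℕ) :
    (2 : ℝ) ^ (k ^ 2) ≤ ‖iteratedDeriv (2 * k) lacunary 0‖ := by
  rw [iteratedDeriv_lacunary_zero, norm_mul, norm_pow, Complex.norm_I, one_pow, one_mul,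
    Complex.norm_real]
  refine le_trans ?_ (le_abs_self _)
  have h := (summable_lacunary_bound (2 * k)).le_tsum k fun j _ => by positivity
  refine le_trans (le_of_eq ?_) h
  rw [← pow_mul, eq_inv_mul_iff_mul_eq₀ (by positivity), ← pow_add]
  congr 1
  ring

/-- The derivatives of an analytic function satisfy Cauchy's estimates. -/
theorem exists_norm_iteratedDeriv_le {g : ℝ → ℂ} {x : ℝ} (hg : AnalyticAt ℝ g x) :
    ∃ C r : ℝ, 0 < C ∧ 0 < r ∧ ∀ m : ℕ, ‖iteratedDeriv m g x‖ ≤ m.factorial * (C * r ^ m) := by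
  obtain ⟨q, R, hq⟩ := hg
  obtain ⟨ρ, hρ0, hρ⟩ := ENNReal.lt_iff_exists_nnreal_btwn.1 (hq.r_pos.trans_le hq.r_le)
  obtain ⟨C, hC, hb⟩ := q.norm_mul_pow_le_of_lt_radius hρ
  have hρ0' : (0 : ℝ) < ρ := by exact_mod_cast hρ0
  refine ⟨C, (ρ : ℝ)⁻¹, hC, inv_pos.2 hρ0', fun m => ?_⟩
  rw [iteratedDeriv_eq_iteratedFDeriv, ← hq.factorial_smul (1 : ℝ) m, nsmul_eq_mul, norm_mul,
    Complex.norm_natCast]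
  gcongr
  rw [inv_pow, ← div_eq_mul_inv, le_div_iff₀ (by positivity)]
  refine le_trans ?_ (hb m)
  gcongr
  refine ((q m).le_opNorm _).trans (le_of_eq ?_)
  simp

theorem not_analyticAt_lacunary_zero : ¬ AnalyticAt ℝ lacunary 0 := by
  intro hg
  obtain ⟨C, r, hC, hr, hb⟩ := exists_norm_iteratedDeriv_le hg
  -- With `D ≥ 1` and `k ≥ 1`, `C ≤ D ^ k`; the Cauchy bound then becomes a k-th power, to be
  -- compared with `(2 ^ k) ^ k`.
  set D := max C 1 with hD
  have hD1 : 1 ≤ D := le_max_right _ _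
  have hlim : Tendsto (fun k : ℕ => (4 * r ^ 2 * D) * ((k : ℝ) ^ 2 / 2 ^ k)) atTop (𝓝 0) := by
    simpa using (tendsto_pow_const_div_const_pow_of_one_lt 2 (r := (2 : ℝ)) (by norm_num)).const_mul
      (4 * r ^ 2 * D)
  obtain ⟨k, hk, hk1⟩ := ((hlim.eventually_lt_const zero_lt_one).and (eventually_ge_atTop 1)).exists
  have h1 : D * (2 * k * r) ^ 2 < 2 ^ k := by
    rw [← mul_div_assoc, div_lt_one (by positivity)] at hk
    linarith
  have h2 : (D * (2 * k * r) ^ 2) ^ k < (2 ^ k) ^ k :=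
    pow_lt_pow_left₀ h1 (by positivity) (by omega)
  have h3 := (two_pow_sq_le_norm_iteratedDeriv_lacunary k).trans (hb (2 * k))
  have h4 : ((2 * k).factorial : ℝ) ≤ (2 * k) ^ (2 * k) := by
    exact_mod_cast Nat.factorial_le_pow (2 * k)
  have h5 : C ≤ D ^ k := (le_max_left _ _).trans (le_self_pow₀ hD1 (by omega))
  have h6 : ((2 * k).factorial : ℝ) * (C * r ^ (2 * k)) ≤
      (2 * k) ^ (2 * k) * (D ^ k * r ^ (2 * k)) := by gcongr
  have h7 : (D * (2 * k * r) ^ 2) ^ k = (2 * k : ℝ) ^ (2 * k) * (D ^ k * r ^ (2 * k)) := by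
    rw [mul_pow, ← pow_mul, mul_pow]; ring
  have h8 : ((2 : ℝ) ^ k) ^ k = 2 ^ (k ^ 2) := by rw [← pow_mul, sq]
  linarith

/-- A translation by a dyadic multiple of `2π` does not change the tail of the series. -/
theorem lacunaryTerm_add_dyadic (N k : ℕ) (hk : N ≤ k) (j : ℤ) (x : ℝ) :
    lacunaryTerm k (x + 2 * Real.pi * j / 2 ^ N) = lacunaryTerm k x := by
  obtain ⟨l, rfl⟩ := Nat.exists_eq_add_of_le hk
  unfold lacunaryTerm
  congr 1
  refine Complex.exp_eq_exp_iff_exists_int.2 ⟨2 ^ l * j, ?_⟩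
  push_cast
  rw [pow_add]
  field_simp

/-- The translation by `d` fixes all terms of index at least `N`, so it changes the series only by a
finite sum of analytic terms. -/
theorem analyticAt_lacunary_zero_of_dyadic (N : ℕ) (j : ℤ)
    (h : AnalyticAt ℝ lacunary (2 * Real.pi * j / 2 ^ N)) : AnalyticAt ℝ lacunary 0 := by
  set d : ℝ := 2 * Real.pi * j / 2 ^ N with hd
  have hadd : AnalyticAt ℝ (fun x : ℝ => x + d) 0 := analyticAt_id.add analyticAt_const
  have hsub : lacunary = fun x => lacunary (x + d) -
      ∑ k ∈ Finset.range N, (lacunaryTerm k (x + d) - lacunaryTerm k x) := by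
    funext x
    have h1 : lacunary (x + d) - lacunary x =
        ∑' k, (lacunaryTerm k (x + d) - lacunaryTerm k x) :=
      ((summable_lacunaryTerm _).tsum_sub (summable_lacunaryTerm _)).symm
    rw [tsum_eq_sum (s := Finset.range N)] at h1
    · rw [← h1]; ring
    · intro k hk
      rw [lacunaryTerm_add_dyadic N k (by simpa using hk) j x, sub_self]
  rw [hsub]
  refine AnalyticAt.sub (AnalyticAt.comp_of_eq (g := lacunary) h hadd (by simp)) ?_
  refine Finset.analyticAt_fun_sum _ fun k _ => AnalyticAt.sub ?_ (analyticAt_lacunaryTerm k 0)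
  exact AnalyticAt.comp_of_eq (g := lacunaryTerm k) (analyticAt_lacunaryTerm k (0 + d)) hadd rfl

/-- The points of analyticity form an open set, and dyadic multiples of 2π are dense. -/
theorem not_analyticAt_lacunary (x : ℝ) : ¬ AnalyticAt ℝ lacunary x := by
  intro h
  obtain ⟨δ, hδ, hball⟩ := Metric.eventually_nhds_iff.1 h.eventually_analyticAt
  have hlim : Tendsto (fun N : ℕ => 2 * Real.pi * (1 / 2 : ℝ) ^ N) atTop (𝓝 0) := by
    simpa using (tendsto_pow_atTop_nhds_zero_of_lt_one (r := (1 / 2 : ℝ)) (by norm_num)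
      (by norm_num)).const_mul (2 * Real.pi)
  obtain ⟨N, hN⟩ := (hlim.eventually_lt_const hδ).exists
  have hw : 0 < 2 * Real.pi * (1 / 2 : ℝ) ^ N := by positivity
  set w := 2 * Real.pi * (1 / 2 : ℝ) ^ N with hw'
  refine not_analyticAt_lacunary_zero (analyticAt_lacunary_zero_of_dyadic N ⌊x / w⌋ (hball ?_))
  have e : 2 * Real.pi * ⌊x / w⌋ / 2 ^ N = ⌊x / w⌋ * w := by
    rw [hw', one_div, inv_pow]; ring
  have h1 := (le_div_iff₀ hw).1 (Int.floor_le (x / w))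
  have h2 := (div_lt_iff₀ hw).1 (Int.lt_floor_add_one (x / w))
  rw [e, Real.dist_eq, abs_lt]
  constructor <;> nlinarith

/-! ### The topology of `C^p(𝕋ⁿ)` -/

theorem withSeminorms_seminormFamily (n : ℕ) (p : ℕ∞) : WithSeminorms (seminormFamily n p) := ⟨rfl⟩

instance (n : ℕ) (p : ℕ∞) : IsTopologicalAddGroup (CpTorus n p) :=
  (seminormFamily n p).addGroupFilterBasis.isTopologicalAddGroup

instance (n : ℕ) (p : ℕ∞) : ContinuousSMul ℂ (CpTorus n p) :=
  (seminormFamily n p).moduleFilterBasis.continuousSMul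

theorem multiDeriv_zero {n : ℕ} (g : (Fin n → ℝ) → ℂ) : multiDeriv 0 g = g := by
  unfold multiDeriv partialsAlong
  induction List.finRange n with
  | nil => rfl
  | cons i l ih => exact ih

/-- Evaluation at a point of the torus, in angular coordinates. -/
def evalLinear {n : ℕ} {p : ℕ∞} (θ : Fin n → ℝ) : CpTorus n p →ₗ[ℂ] ℂ where
  toFun f := lift f θ
  map_add' _ _ := rfl
  map_smul' _ _ := rfl

/-- Evaluation is linear and dominated by the seminorm with `α = 0`. -/
theorem continuous_lift_apply {n : ℕ} {p : ℕ∞} (θ : Fin n → ℝ) :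
    Continuous fun f : CpTorus n p => lift f θ := by
  have h0 : ((∑ i, (0 : Fin n → ℕ) i : ℕ) : ℕ∞) ≤ p := by simp
  have hle : ∀ f : CpTorus n p, ‖evalLinear θ f‖ ≤ seminormFamily n p ⟨0, h0⟩ f := by
    intro f
    have h : ‖multiDeriv 0 (lift f) θ‖ ≤ seminormFamily n p ⟨0, h0⟩ f :=
      le_ciSup (bddAbove_multiDeriv h0 f) θ
    rwa [multiDeriv_zero] at h
  have hlim : Tendsto (fun f : CpTorus n p => seminormFamily n p ⟨0, h0⟩ f) (𝓝 0) (𝓝 0) := by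
    simpa using ((withSeminorms_seminormFamily n p).continuous_seminorm ⟨0, h0⟩).tendsto 0
  refine continuous_of_continuousAt_zero (evalLinear θ : CpTorus n p →ₗ[ℂ] ℂ) ?_
  rw [ContinuousAt, map_zero]
  exact squeeze_zero_norm hle hlim

/-! ### Functions that are not analytic at a point form a `G_δ` set -/

instance (n m : ℕ) : ProperSpace ((Fin n → ℝ) [×m]→L[ℝ] ℂ) := by
  have : FiniteDimensional ℝ ((Fin n → ℝ) [×m]→L[ℝ] ℂ) :=
    FiniteDimensional.of_injective
      (ContinuousMultilinearMap.toMultilinearMapLinear (R' := ℝ) (A := ℝ)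
        (M₁ := fun _ : Fin m => Fin n → ℝ) (M₂ := ℂ))
      ContinuousMultilinearMap.toMultilinearMap_injective
  exact FiniteDimensional.proper_real _

/-- Power series on `ℝⁿ` whose coefficients satisfy `‖q m‖ ≤ M ^ (m + 1)`. -/
abbrev BoundedSeries (n : ℕ) (M : ℝ) : Type :=
  ∀ m : ℕ, Metric.closedBall (0 : (Fin n → ℝ) [×m]→L[ℝ] ℂ) (M ^ (m + 1))

instance (n : ℕ) (M : ℝ) : CompactSpace (BoundedSeries n M) :=
  haveI (m : ℕ) : CompactSpace (Metric.closedBall (0 : (Fin n → ℝ) [×m]→L[ℝ] ℂ) (M ^ (m + 1))) :=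
    isCompact_iff_compactSpace.1 (isCompact_closedBall _ _)
  inferInstance

/-- The radius `(2 * M)⁻¹` makes the ratio `M * ‖y‖` at most 1/2, giving a majorant independent of
`q` and `y`. -/
theorem norm_boundedSeries_apply_le {n : ℕ} {M : ℝ} (hM : 0 < M) (q : BoundedSeries n M)
    {y : Fin n → ℝ} (hy : ‖y‖ ≤ (2 * M)⁻¹) (m : ℕ) :
    ‖(q m : (Fin n → ℝ) [×m]→L[ℝ] ℂ) fun _ => y‖ ≤ M * (1 / 2) ^ m := by
  have hq : ‖(q m : (Fin n → ℝ) [×m]→L[ℝ] ℂ)‖ ≤ M ^ (m + 1) := mem_closedBall_zero_iff.1 (q m).2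
  calc ‖(q m : (Fin n → ℝ) [×m]→L[ℝ] ℂ) fun _ => y‖
      ≤ ‖(q m : (Fin n → ℝ) [×m]→L[ℝ] ℂ)‖ * ‖y‖ ^ m := by
        simpa using (q m : (Fin n → ℝ) [×m]→L[ℝ] ℂ).le_opNorm fun _ => y
    _ ≤ M ^ (m + 1) * ((2 * M)⁻¹) ^ m := by gcongr
    _ = M * (1 / 2) ^ m := by
        rw [pow_succ', mul_assoc, ← mul_pow]
        congr 2
        field_simp

theorem summable_boundedSeries_majorant (M : ℝ) : Summable fun m : ℕ => M * (1 / 2 : ℝ) ^ m :=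
  (summable_geometric_of_lt_one (by norm_num) (by norm_num)).mul_left M

/-- The functions that near `θ` are the sum of a power series with coefficients bounded by
`M ^ (m + 1)`. -/
def boundedAnalyticSet (n : ℕ) (p : ℕ∞) (θ : Fin n → ℝ) (M : ℝ) : Set (CpTorus n p) :=
  {f | ∃ q : BoundedSeries n M, ∀ y : Fin n → ℝ, ‖y‖ ≤ (2 * M)⁻¹ →
    lift f (θ + y) = ∑' m, (q m : (Fin n → ℝ) [×m]→L[ℝ] ℂ) fun _ => y}

/-- The pairs (series, function) that agree form a closed set, and projection along a compact factor
is a closed map. -/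
theorem isClosed_boundedAnalyticSet {n : ℕ} {p : ℕ∞} (θ : Fin n → ℝ) {M : ℝ} (hM : 0 < M) :
    IsClosed (boundedAnalyticSet n p θ M) := by
  have hcl : IsClosed {x : BoundedSeries n M × CpTorus n p | ∀ y : Fin n → ℝ, ‖y‖ ≤ (2 * M)⁻¹ →
      lift x.2 (θ + y) = ∑' m, (x.1 m : (Fin n → ℝ) [×m]→L[ℝ] ℂ) fun _ => y} := by
    simp only [Set.ofPred_forall]
    refine isClosed_iInter fun y => isClosed_iInter fun hy => isClosed_eq
      ((continuous_lift_apply _).comp continuous_snd) ?_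
    refine continuous_tsum (fun m => ?_) (summable_boundedSeries_majorant M)
      fun m x => norm_boundedSeries_apply_le hM x.1 hy m
    exact (ContinuousMultilinearMap.apply ℝ (fun _ : Fin m => Fin n → ℝ) ℂ
      fun _ => y).continuous.comp
        (continuous_subtype_val.comp ((continuous_apply m).comp continuous_fst))
  convert isClosedMap_snd_of_compactSpace _ hcl using 1
  ext f
  simp [boundedAnalyticSet]

theorem analyticAt_lift_iff {n : ℕ} {p : ℕ∞} (f : CpTorus n p) (θ : Fin n → ℝ) :
    AnalyticAt ℝ (lift f) θ ↔ ∃ N : ℕ, f ∈ boundedAnalyticSet n p θ (N + 1) := by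
  constructor
  · rintro ⟨q, R, hq⟩
    obtain ⟨ρ, hρ0, hρ⟩ := ENNReal.lt_iff_exists_nnreal_btwn.1 hq.r_pos
    obtain ⟨C, hC, hb⟩ := q.norm_mul_pow_le_of_lt_radius (hρ.trans_le hq.r_le)
    have hρ0' : (0 : ℝ) < ρ := by exact_mod_cast hρ0
    -- This one `N` both bounds the coefficients and places the ball of radius `(2 * (N + 1))⁻¹`
    -- inside that of radius `ρ`.
    obtain ⟨N, hN⟩ := exists_nat_ge (max C (ρ : ℝ)⁻¹)
    have hCN : C ≤ (N : ℝ) + 1 := (le_max_left _ _).trans (hN.trans (by linarith))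
    have hρN : (ρ : ℝ)⁻¹ ≤ (N : ℝ) + 1 := (le_max_right _ _).trans (hN.trans (by linarith))
    refine ⟨N, fun m => ⟨q m, mem_closedBall_zero_iff.2 ?_⟩, fun y hy => ?_⟩
    · calc ‖q m‖ ≤ C * (ρ : ℝ)⁻¹ ^ m := by
            rw [inv_pow, ← div_eq_mul_inv, le_div_iff₀ (by positivity)]
            exact hb m
        _ ≤ ((N : ℝ) + 1) * ((N : ℝ) + 1) ^ m := by gcongr
        _ = ((N : ℝ) + 1) ^ (m + 1) := (pow_succ' _ _).symm
    · refine (hq.hasSum ?_).tsum_eq.symm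
      refine Metric.eball_subset_eball hρ.le ?_
      rw [Metric.eball_coe, mem_ball_zero_iff]
      refine hy.trans_lt ?_
      rw [inv_lt_comm₀ (by positivity) hρ0']
      have : (0 : ℝ) ≤ N := N.cast_nonneg
      linarith
  · rintro ⟨N, hN⟩
    obtain ⟨M, hM, q, hq⟩ : ∃ M : ℝ, 0 < M ∧ f ∈ boundedAnalyticSet n p θ M :=
      ⟨N + 1, by positivity, hN⟩
    have hr : (0 : ℝ) < (2 * M)⁻¹ := by positivity
    refine ⟨fun m => (q m).1, ENNReal.ofReal (2 * M)⁻¹, ?_, ENNReal.ofReal_pos.2 hr, ?_⟩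
    · refine FormalMultilinearSeries.le_radius_of_bound _ M fun m => ?_
      rw [Real.coe_toNNReal _ hr.le]
      have hqm : ‖(q m).1‖ ≤ M ^ (m + 1) := mem_closedBall_zero_iff.1 (q m).2
      calc ‖(q m).1‖ * (2 * M)⁻¹ ^ m ≤ M ^ (m + 1) * M⁻¹ ^ m := by
            gcongr
            linarith
        _ = M := by rw [pow_succ', mul_assoc, ← mul_pow, mul_inv_cancel₀ hM.ne', one_pow, mul_one]
    · intro y hy
      have hy' : ‖y‖ ≤ (2 * M)⁻¹ := by
        rw [Metric.eball_ofReal, mem_ball_zero_iff] at hy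
        exact hy.le
      rw [hq y hy']
      exact (Summable.of_norm_bounded (summable_boundedSeries_majorant M)
        fun m => norm_boundedSeries_apply_le hM q hy' m).hasSum

/-- The choice of angles is immaterial: two choices differ by a period of `lift f`. -/
theorem realAnalyticAt_iff {n : ℕ} (f : (Fin n → Circle) → ℂ) (θ : Fin n → ℝ) :
    RealAnalyticAt f (fun i => Circle.exp (θ i)) ↔ AnalyticAt ℝ (lift f) θ := by
  refine ⟨?_, fun h => ⟨θ, fun _ => rfl, h⟩⟩
  rintro ⟨θ', hθ', h⟩
  have hper : lift f = lift f ∘ fun t => t + (θ' - θ) := by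
    funext t
    refine congrArg f (funext fun i => ?_)
    have : Circle.exp (θ' i - θ i) = 1 := by rw [Circle.exp_sub, hθ' i, div_self']
    simp [Circle.exp_add, this]
  rw [hper]
  exact h.comp_of_eq (analyticAt_id.add analyticAt_const) (by simp)

theorem exists_circle_exp_eq {n : ℕ} (ζ : Fin n → Circle) :
    ∃ θ : Fin n → ℝ, (fun i => Circle.exp (θ i)) = ζ :=
  ⟨fun i => Complex.arg (ζ i), funext fun i => Circle.exp_arg (ζ i)⟩

theorem isGδ_not_realAnalyticAt {n : ℕ} (p : ℕ∞) (ζ : Fin n → Circle) :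
    IsGδ {f : CpTorus n p | ¬ RealAnalyticAt f ζ} := by
  obtain ⟨θ, rfl⟩ := exists_circle_exp_eq ζ
  have : {f : CpTorus n p | ¬ RealAnalyticAt f fun i => Circle.exp (θ i)} =
      ⋂ N : ℕ, (boundedAnalyticSet n p θ (N + 1))ᶜ := by
    ext f
    simp [realAnalyticAt_iff, analyticAt_lift_iff]
  rw [this]
  exact IsGδ.iInter_of_isOpen fun N =>
    (isClosed_boundedAnalyticSet θ (by positivity)).isOpen_compl

/-! ### Passing to countably many points -/

/-- A function analytic somewhere on the torus is analytic at a member of a dense sequence. -/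
theorem exists_realAnalyticAt_denseSeq {n : ℕ} {f : (Fin n → Circle) → ℂ} {ζ : Fin n → Circle}
    (h : RealAnalyticAt f ζ) :
    ∃ k : ℕ, AnalyticAt ℝ (lift f) (TopologicalSpace.denseSeq (Fin n → ℝ) k) := by
  obtain ⟨θ, -, h⟩ := h
  exact (TopologicalSpace.denseRange_denseSeq (Fin n → ℝ)).exists_mem_open
    (isOpen_analyticAt ℝ (lift f)) ⟨θ, h⟩

theorem setOf_forall_not_realAnalyticAt (n : ℕ) (p : ℕ∞) :
    {f : CpTorus n p | ∀ ζ : Fin n → Circle, ¬ RealAnalyticAt f ζ} =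
      ⋂ k : ℕ, {f : CpTorus n p | ¬ RealAnalyticAt f
        fun i => Circle.exp (TopologicalSpace.denseSeq (Fin n → ℝ) k i)} := by
  ext f
  simp only [Set.mem_ofPred_eq, Set.mem_iInter]
  refine ⟨fun h k => h _, fun h ζ hζ => ?_⟩
  obtain ⟨k, hk⟩ := exists_realAnalyticAt_denseSeq hζ
  exact h k ((realAnalyticAt_iff _ _).2 hk)

/-! ### Density -/

/-- The argument recovers the angle up to a multiple of 2π, a period of every term (the dyadic case
`N = 0`). -/
theorem lift_lacunary {n : ℕ} (i : Fin n) :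
    lift (fun ζ : Fin n → Circle => lacunary (Complex.arg (ζ i))) = fun θ => lacunary (θ i) := by
  funext θ
  obtain ⟨m, hm⟩ := Circle.exp_eq_exp.1 (Circle.exp_arg (Circle.exp (θ i)))
  refine tsum_congr fun k => ?_
  rw [← lacunaryTerm_add_dyadic 0 k k.zero_le m (θ i), hm]
  congr 1
  ring

/-- The lacunary series as a function of one of the variables on the torus. -/
def lacunaryTorus {n : ℕ} (p : ℕ∞) (i : Fin n) : CpTorus n p :=
  ⟨fun ζ => lacunary (Complex.arg (ζ i)), by
    change ContDiff ℝ (p : ℕ∞ω) _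
    rw [lift_lacunary]
    exact (contDiff_lacunary.comp (contDiff_apply ℝ ℝ i)).of_le (by exact_mod_cast le_top)⟩

theorem not_analyticAt_lift_lacunaryTorus {n : ℕ} (p : ℕ∞) (i : Fin n) (θ : Fin n → ℝ) :
    ¬ AnalyticAt ℝ (lift (lacunaryTorus p i)) θ := by
  intro h
  replace h : AnalyticAt ℝ (fun θ : Fin n → ℝ => lacunary (θ i)) θ := by
    rw [← lift_lacunary]
    exact h
  have hline : AnalyticAt ℝ (fun t : ℝ => (Function.update θ i t : Fin n → ℝ)) (θ i) :=
    (contDiff_update ω θ i).contDiffAt.analyticAt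
  refine not_analyticAt_lacunary (θ i) ?_
  have := AnalyticAt.comp_of_eq h hline (Function.update_eq_self i θ)
  simpa [Function.comp_def] using this

/-- If `h` is nowhere analytic, then `f + ε h` is nowhere analytic for all but countably many
`ε`. -/
theorem countable_setOf_realAnalyticAt_add_smul {n : ℕ} {p : ℕ∞} (f h : CpTorus n p)
    (hh : ∀ θ, ¬ AnalyticAt ℝ (lift h) θ) :
    {ε : ℝ | ∃ ζ : Fin n → Circle, RealAnalyticAt ⇑(f + (ε : ℂ) • h) ζ}.Countable := by
  refine Set.Countable.mono (s₂ := ⋃ k : ℕ, {ε : ℝ | AnalyticAt ℝ (lift ⇑(f + (ε : ℂ) • h))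
    (TopologicalSpace.denseSeq (Fin n → ℝ) k)}) ?_ (Set.countable_iUnion fun k => ?_)
  · rintro ε ⟨ζ, hζ⟩
    exact Set.mem_iUnion.2 (exists_realAnalyticAt_denseSeq hζ)
  -- Two values `a ≠ b` that are both analytic at this point would make `h`, their difference
  -- quotient, analytic there.
  · refine Set.Subsingleton.countable fun a ha b hb => ?_
    by_contra hab
    refine hh (TopologicalSpace.denseSeq (Fin n → ℝ) k) ?_
    have hne : (a : ℂ) - b ≠ 0 := sub_ne_zero.2 (by exact_mod_cast hab)
    have e : lift h = fun θ => ((a : ℂ) - b)⁻¹ *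
        (lift ⇑(f + (a : ℂ) • h) θ - lift ⇑(f + (b : ℂ) • h) θ) := by
      funext θ
      have key : ∀ c : ℂ, lift ⇑(f + c • h) θ = lift f θ + c * lift h θ := fun _ => rfl
      rw [key, key, eq_inv_mul_iff_mul_eq₀ hne]
      ring
    rw [e]
    exact analyticAt_const.mul (AnalyticAt.sub ha hb)

theorem dense_forall_not_realAnalyticAt {n : ℕ} (hn : 1 ≤ n) (p : ℕ∞) :
    Dense {f : CpTorus n p | ∀ ζ : Fin n → Circle, ¬ RealAnalyticAt f ζ} := by
  intro f
  set h : CpTorus n p := lacunaryTorus p ⟨0, hn⟩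
  have hd := (countable_setOf_realAnalyticAt_add_smul f h
    (not_analyticAt_lift_lacunaryTorus p _)).dense_compl ℝ
  have hc : Continuous fun ε : ℝ => f + (ε : ℂ) • h :=
    continuous_const.add (Complex.continuous_ofReal.smul continuous_const)
  -- 0 is a limit of good `ε`, and `ε ↦ f + ε h` is continuous with value `f` at 0.
  have hmem := image_closure_subset_closure_image hc ⟨0, hd 0, rfl⟩
  simp only [Complex.ofReal_zero, zero_smul, add_zero] at hmem
  refine closure_mono ?_ hmem
  rintro _ ⟨ε, hε, rfl⟩ ζ hζ
  exact hε ⟨ζ, hζ⟩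

end TorusCp

end

theorem mainTheorem7 (n : ℕ) (hn : 1 ≤ n) (p : ℕ∞) :
    (∀ ζ : Fin n → Circle,
      IsGδ {f : TorusCp.CpTorus n p | ¬ TorusCp.RealAnalyticAt f ζ} ∧
      Dense {f : TorusCp.CpTorus n p | ¬ TorusCp.RealAnalyticAt f ζ}) ∧
    (IsGδ {f : TorusCp.CpTorus n p | ∀ ζ : Fin n → Circle, ¬ TorusCp.RealAnalyticAt f ζ} ∧
      Dense {f : TorusCp.CpTorus n p | ∀ ζ : Fin n → Circle, ¬ TorusCp.RealAnalyticAt f ζ}) := by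
  have hd := TorusCp.dense_forall_not_realAnalyticAt hn p
  refine ⟨fun ζ => ⟨TorusCp.isGδ_not_realAnalyticAt p ζ, Dense.mono ?_ hd⟩, ?_, hd⟩
  · exact fun f hf => hf ζ
  · rw [TorusCp.setOf_forall_not_realAnalyticAt]
    exact IsGδ.iInter fun k => TorusCp.isGδ_not_realAnalyticAt p _
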